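/- Let $d\ge 2$ and $n\ge 2$ be integers, and let $\mu_d=\{\xi\in\mathbb{C}^*\mid \xi^d=1\}$ act on affine space $\mathbb{A}^n=\mathbb{C}^n$ over $\mathbb{C}$ by scalar multiplication. Let $A_{d,n}:=\mathbb{A}^n/\mu_d$ be the quotient, i.e. the affine variety over $\mathbb{C}$ with coordinate ring $\mathcal{O}(A_{d,n})=\mathbb{C}[x_1,\dots,x_n]^{\mu_d}$, and let $\pi:\mathbb{A}^n\to A_{d,n}$ be the quotient morphism, given by the inclusion $\mathbb{C}[x_1,\dots,x_n]^{\mu_d}\subset\mathbb{C}[x_1,\dots,x_n]$. Then every automorphism of $A_{d,n}$ lifts to a polynomial automorphism of $\mathbb{C}^n$: for every automorphism $\varphi$ of the $\mathbb{C}$-variety $A_{d,n}$ there is an automorphism $\psi$ of the $\mathbb{C}$-variety $\mathbb{A}^n$ with $\pi\circ\psi=\varphi\circ\pi$. -/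

import Mathlib

open CategoryTheory AlgebraicGeometry

noncomputable section

namespace CyclicQuotient

/-- The `ℂ`-algebra endomorphism of `ℂ[x₁, …, xₙ]` with `xᵢ ↦ ζ xᵢ`, that is,
the pull-back of polynomial functions along `v ↦ ζ • v` on affine space. -/
def scale (n : ℕ) (ζ : ℂ) : MvPolynomial (Fin n) ℂ →ₐ[ℂ] MvPolynomial (Fin n) ℂ :=
  MvPolynomial.aeval fun i => MvPolynomial.C ζ * MvPolynomial.X i

/-- The algebra of invariants `ℂ[x₁, …, xₙ]^{μ_d}` for the group `μ_d` of `d`-th roots of unity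
acting by scalar multiplication. -/
def invariants (d n : ℕ) : Subalgebra ℂ (MvPolynomial (Fin n) ℂ) :=
  ⨅ ζ : rootsOfUnity d ℂ, AlgHom.equalizer (scale n ((ζ : ℂˣ) : ℂ)) (AlgHom.id ℂ _)

theorem mem_invariants {d n : ℕ} {f : MvPolynomial (Fin n) ℂ} :
    f ∈ invariants d n ↔ ∀ ζ : rootsOfUnity d ℂ, scale n ((ζ : ℂˣ) : ℂ) f = f := by
  simp [invariants, Algebra.mem_iInf, AlgHom.mem_equalizer]

/-- The base scheme `Spec ℂ`. -/
abbrev base : Scheme.{0} := Spec (.of ℂ)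

/-- Affine `n`-space over `ℂ`. -/
abbrev affineSpace (n : ℕ) : Scheme.{0} := AffineSpace (Fin n) base

/-- The quotient variety `A_{d,n} = 𝔸ⁿ / μ_d`, the affine variety whose coordinate ring is the
algebra of invariants. -/
def quotientVariety (d n : ℕ) : Scheme.{0} := Spec (.of (invariants d n))

/-- The structure morphism of `A_{d,n}` over `ℂ`. -/
instance quotientVarietyOver (d n : ℕ) : (quotientVariety d n).Over base :=
  ⟨Spec.map (CommRingCat.ofHom (algebraMap ℂ (invariants d n)))⟩

/-- The quotient morphism `π : 𝔸ⁿ ⟶ A_{d,n}`, given on coordinate rings by the inclusion of the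
invariants in `ℂ[x₁, …, xₙ]`. -/
def quotientMap (d n : ℕ) : affineSpace n ⟶ quotientVariety d n :=
  (AffineSpace.SpecIso (Fin n) (.of ℂ)).hom ≫
    Spec.map (CommRingCat.ofHom (invariants d n).val.toRingHom)

end CyclicQuotient

end

/-!
The invariants of `μ_d` form the `d`-th Veronese subalgebra `V`. Let `α` be an automorphism of `V`.
A prime ideal of `V` containing all `xᵢ ^ d` contains every element without constant term, so a
prime `p` dividing all `α (xᵢ ^ d)` would divide `xᵢ ^ d - cᵢ` for suitable constants `cᵢ`, which
is impossible in two or more variables. If `p` does not divide `α (xᵢ ^ d)`, the relation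
`α (xᵢ ^ d) ^ (d - 1) * α (xⱼ ^ d) = α (xᵢ ^ (d - 1) * xⱼ) ^ d` shows that `p` occurs in
`α (xⱼ ^ d)` with multiplicity divisible by `d`. Hence `α (xⱼ ^ d) = F ^ d` for some polynomial
`F`, and `F ^ (d - 1)` divides `α (xⱼ ^ (d - 1) * xᵢ)`; the quotients are the images of the `xᵢ`
under an extension of `α`. Extensions of `α` and `α⁻¹` compose to endomorphisms fixing `V`, which
rescale each variable by a unit and are therefore bijective.
-/

noncomputable section

namespace CyclicQuotient

open MvPolynomial

section Veronese

variable {σ R : Type*} [CommSemiring R] {d : ℕ}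

variable (σ R d) in
/-- The `d`-th Veronese subalgebra of `R[xᵢ | i ∈ σ]`, spanned by the monomials whose degree is
divisible by `d`. -/
def veronese : Subalgebra R (MvPolynomial σ R) :=
  (restrictSupport R {m : σ →₀ ℕ | d ∣ m.degree}).toSubalgebra
    ((monomial_mem_restrictSupport R).2 (.inl (by simp)))
    fun _ _ hf hg => restrictSupport_mono R
      (Set.add_subset_iff.2 fun m hm l hl => by simpa using dvd_add hm hl)
      (restrictSupport_add R _ _ ▸ Submodule.mul_mem_mul hf hg)

theorem mem_veronese {f : MvPolynomial σ R} :
    f ∈ veronese σ R d ↔ ∀ m ∈ f.support, d ∣ m.degree :=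
  mem_restrictSupport_iff R

theorem monomial_mem_veronese {m : σ →₀ ℕ} (hm : d ∣ m.degree) (c : R) :
    monomial m c ∈ veronese σ R d :=
  (monomial_mem_restrictSupport R).2 (.inl hm)

@[elab_as_elim]
theorem veronese_induction {motive : veronese σ R d → Prop}
    (monomial : ∀ m (hm : d ∣ m.degree) c, motive ⟨monomial m c, monomial_mem_veronese hm c⟩)
    (add : ∀ a b, motive a → motive b → motive (a + b)) (a : veronese σ R d) : motive a := by
  have hdvd (m : a.1.support) : d ∣ m.1.degree := mem_veronese.1 a.2 m m.2
  have hsum : a = ∑ m : a.1.support,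
      ⟨MvPolynomial.monomial m.1 (coeff m.1 a.1), monomial_mem_veronese (hdvd m) _⟩ := by
    apply Subtype.ext
    rw [AddSubmonoidClass.coe_finsetSum]
    exact a.1.as_sum.trans (Finset.sum_attach _ _).symm
  have hzero : motive 0 := by
    convert monomial 0 (by simp) 0
    simp
  rw [hsum]
  exact Finset.sum_induction _ motive add hzero fun m _ => monomial m.1 (hdvd m) _

variable (R d) in
/-- The element `xᵢ ^ d` of the Veronese subalgebra. -/
def powVar (i : σ) : veronese σ R d :=
  ⟨X i ^ d, by
    rw [X_pow_eq_monomial]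
    exact monomial_mem_veronese (by simp) 1⟩

variable (R d) in
/-- The element `xⱼ ^ (d - 1) * xᵢ` of the Veronese subalgebra. Its quotient by `xⱼ ^ d` is the
rational function `xᵢ / xⱼ`. -/
def mixedVar [NeZero d] (j i : σ) : veronese σ R d :=
  ⟨X j ^ (d - 1) * X i, by
    rw [X_pow_eq_monomial, X, monomial_mul]
    refine monomial_mem_veronese ?_ _
    rw [map_add, Finsupp.degree_single, Finsupp.degree_single, Nat.sub_add_cancel NeZero.one_le]⟩

@[simp]
theorem coe_powVar (i : σ) : (powVar R d i : MvPolynomial σ R) = X i ^ d := rfl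

@[simp]
theorem coe_mixedVar [NeZero d] (j i : σ) :
    (mixedVar R d j i : MvPolynomial σ R) = X j ^ (d - 1) * X i := rfl

theorem powVar_ne_zero [IsDomain R] (i : σ) : powVar R d i ≠ 0 :=
  fun h => pow_ne_zero d (X_ne_zero i) (congrArg Subtype.val h)

theorem powVar_pow_mul_powVar [NeZero d] (j i : σ) :
    powVar R d j ^ (d - 1) * powVar R d i = mixedVar R d j i ^ d :=
  Subtype.ext <| by simp [mul_pow, pow_right_comm]

theorem powVar_dvd_monomial_pow {m : σ →₀ ℕ} (hm : d ∣ m.degree) (c : R) {i : σ} (hi : m i ≠ 0) :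
    powVar R d i ∣ ⟨monomial m c, monomial_mem_veronese hm c⟩ ^ d := by
  obtain ⟨l, rfl⟩ : ∃ l, m = Finsupp.single i 1 + l :=
    ⟨_, (add_tsub_cancel_of_le (by simpa [Nat.one_le_iff_ne_zero])).symm⟩
  refine ⟨⟨monomial (d • l) (c ^ d), monomial_mem_veronese (by simp) _⟩, Subtype.ext ?_⟩
  simp [monomial_pow, X_pow_eq_monomial, monomial_mul]

theorem finsuppProd_mul_pow {M : Type*} [CommMonoid M] (a : M) (f : σ → M) (m : σ →₀ ℕ) :
    (m.prod fun i e => (a * f i) ^ e) = a ^ m.degree * m.prod fun i e => f i ^ e := by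
  simp only [Finsupp.prod, mul_pow, Finset.prod_mul_distrib, Finset.prod_pow_eq_pow_sum,
    Finsupp.degree_apply]

theorem finsuppProd_mixedVar_pow [NeZero d] (j : σ) {m : σ →₀ ℕ} {k : ℕ} (hm : m.degree = d * k) :
    (m.prod fun i e => mixedVar R d j i ^ e) = powVar R d j ^ ((d - 1) * k) *
      ⟨monomial m 1, monomial_mem_veronese (Dvd.intro _ hm.symm) 1⟩ := by
  refine Subtype.ext ((map_finsuppProd (veronese σ R d).val _ _).trans ?_)
  simp only [map_pow, Subalgebra.coe_val, coe_mixedVar, MulMemClass.coe_mul,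
    SubmonoidClass.coe_pow, coe_powVar]
  rw [finsuppProd_mul_pow, monomial_eq, C_1, one_mul, hm]
  ring

/-- On the chart `xⱼ ≠ 0` an extension must send `xᵢ = xⱼ * (xⱼ ^ (d - 1) * xᵢ) / xⱼ ^ d` to
`F * φ (xⱼ ^ (d - 1) * xᵢ) / F ^ d`; the divisibility hypothesis makes this an element of `A`. -/
theorem exists_algHom_extends_of_forall_dvd [NeZero d] {A : Type*} [CommSemiring A]
    [IsDomain A] [Algebra R A] (φ : veronese σ R d →ₐ[R] A) {j : σ} {F : A} (hF0 : F ≠ 0)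
    (hF : F ^ d = φ (powVar R d j))
    (hdvd : ∀ i, F ^ (d - 1) ∣ φ (mixedVar R d j i)) :
    ∃ Ψ : MvPolynomial σ R →ₐ[R] A, ∀ a : veronese σ R d, Ψ a = φ a := by
  choose f hf using hdvd
  have hmonomial {m : σ →₀ ℕ} (hm : d ∣ m.degree) : (m.prod fun i e => f i ^ e) =
      φ ⟨monomial m 1, monomial_mem_veronese hm 1⟩ := by
    obtain ⟨k, hk⟩ := hm
    have hexp : (d - 1) * m.degree = d * ((d - 1) * k) := by rw [hk, mul_left_comm]
    have h := congrArg φ (finsuppProd_mixedVar_pow (R := R) j hk)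
    simp only [map_finsuppProd, map_mul, map_pow, hf, finsuppProd_mul_pow, ← hF] at h
    rw [← pow_mul, ← pow_mul, hexp] at h
    exact mul_left_cancel₀ (pow_ne_zero _ hF0) h
  refine ⟨aeval f, fun a => ?_⟩
  induction a using veronese_induction with
  | monomial m hm c =>
    rw [aeval_monomial, hmonomial hm, ← Algebra.smul_def, ← map_smul]
    congr 1
    exact Subtype.ext (by simp [smul_monomial])
  | add a b ha hb => simp only [AddMemClass.coe_add, map_add, ha, hb]

end Veronese

theorem mem_of_forall_powVar_mem {σ R : Type*} [CommRing R] {d : ℕ} {P : Ideal (veronese σ R d)}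
    [P.IsPrime] (hP : ∀ i, powVar R d i ∈ P) {a : veronese σ R d} (ha : constantCoeff a.1 = 0) :
    a ∈ P := by
  suffices h : a - algebraMap R _ (constantCoeff a.1) ∈ P by simpa [ha] using h
  clear ha
  induction a using veronese_induction with
  | monomial m hm c =>
    by_cases hm0 : m = 0
    · subst hm0
      convert P.zero_mem
      exact Subtype.ext (by simp [algebraMap_eq])
    · obtain ⟨i, hi⟩ := Finsupp.ne_iff.1 hm0
      have hmem : ⟨monomial m c, monomial_mem_veronese hm c⟩ ∈ P :=
        ‹P.IsPrime›.mem_of_pow_mem d (P.mem_of_dvd (powVar_dvd_monomial_pow hm c hi) (hP i))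
      have hcoeff : constantCoeff (monomial m c) = 0 := by
        classical rw [constantCoeff_monomial, if_neg hm0]
      rwa [hcoeff, map_zero, sub_zero]
  | add a b ha hb =>
    convert P.add_mem ha hb using 1
    simp only [AddMemClass.coe_add, map_add]
    ring

theorem eq_C_of_forall_exists_dvd {σ R : Type*} [CommSemiring R] [NoZeroDivisors R]
    {p : MvPolynomial σ R} (h : ∀ j, ∃ q, q ≠ 0 ∧ degreeOf j q = 0 ∧ p ∣ q) :
    p = C (coeff 0 p) := by
  have hdeg (j : σ) : degreeOf j p = 0 := by
    obtain ⟨_, hq0, hq, r, rfl⟩ := h j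
    rw [degreeOf_mul_eq (left_ne_zero_of_mul hq0) (right_ne_zero_of_mul hq0)] at hq
    exact Nat.eq_zero_of_add_eq_zero_right hq
  rw [← totalDegree_eq_zero_iff_eq_C, totalDegree_eq_zero_iff]
  exact fun m hm i => Nat.le_zero.1 ((monomial_le_degreeOf i hm).trans (hdeg i).le)

theorem X_pow_sub_C_ne_zero {σ R : Type*} [CommRing R] [Nontrivial R] {d : ℕ} [NeZero d] (i : σ)
    (c : R) : (X i ^ d - C c : MvPolynomial σ R) ≠ 0 :=
  sub_ne_zero.2 fun h => NeZero.ne d (by simpa using congrArg totalDegree h)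

theorem degreeOf_X_pow_sub_C_of_ne {σ R : Type*} [CommRing R] [Nontrivial R] {d : ℕ}
    {i j : σ} (hij : i ≠ j) (c : R) :
    degreeOf j (X i ^ d - C c : MvPolynomial σ R) = 0 := by
  have hX : degreeOf j (X i ^ d : MvPolynomial σ R) = 0 :=
    Nat.le_zero.1 <| (degreeOf_pow_le j _ d).trans <| by
      rw [degreeOf_X_of_ne hij.symm, mul_zero]
  simpa [hX] using degreeOf_sub_le j (X i ^ d) (C c : MvPolynomial σ R)

theorem exists_associated_pow_of_forall_prime {M : Type*} [CommMonoidWithZero M]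
    [UniqueFactorizationMonoid M] {a : M} (ha : a ≠ 0) {d : ℕ} (hd : d ≠ 0)
    (h : ∀ p, Prime p → ∃ b c, ¬ p ∣ b ∧ b * a = c ^ d) : ∃ f, Associated (f ^ d) a := by
  classical
  have : Nontrivial M := ⟨a, 0, ha⟩
  obtain ⟨f, hf⟩ : ∃ f : Associates M, Associates.mk a = f ^ d := by
    refine Associates.is_pow_of_dvd_count (Associates.mk_ne_zero.2 ha) fun q hq => ?_
    obtain ⟨p, rfl⟩ := Associates.mk_surjective q
    have hp : Irreducible p := Associates.irreducible_mk.1 hq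
    obtain ⟨b, c, hpb, hbc⟩ := h p hp.prime
    have hb : b ≠ 0 := fun hb => hpb (hb ▸ dvd_zero p)
    have hc : c ≠ 0 := fun hc => mul_ne_zero hb ha (by rw [hbc, hc, zero_pow hd])
    have hcount : (Associates.mk p).count (Associates.mk b).factors = 0 :=
      not_ne_iff.1 (mt (Associates.count_ne_zero_iff_dvd hb hp).1 hpb)
    have hdvd := Associates.dvd_count_pow (Associates.mk_ne_zero.2 hc) hq d
    rwa [← Associates.mk_pow, ← hbc, ← Associates.mk_mul_mk,
      Associates.count_mul (Associates.mk_ne_zero.2 hb) (Associates.mk_ne_zero.2 ha) hq, hcount,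
      zero_add] at hdvd
  obtain ⟨f, rfl⟩ := Associates.mk_surjective f
  exact ⟨f, (Associates.mk_eq_mk_iff_associated.1 (by rw [hf, Associates.mk_pow])).symm⟩

theorem bijective_aeval_units_smul_X {σ R : Type*} [CommSemiring R] (u : σ → Rˣ) :
    Function.Bijective (aeval (R := R) fun i => u i • (X i : MvPolynomial σ R)) := by
  have hcomp (v w : σ → Rˣ) (hvw : ∀ i, v i * w i = 1) (f : MvPolynomial σ R) :
      aeval (fun i => v i • (X i : MvPolynomial σ R))
        (aeval (fun i => w i • (X i : MvPolynomial σ R)) f) = f := by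
    induction f using MvPolynomial.induction_on with
    | C c => simp
    | add f g hf hg => simp only [map_add, hf, hg]
    | mul_X f i hf =>
      rw [map_mul, map_mul, hf, aeval_X, Units.smul_def, map_smul, aeval_X, ← Units.smul_def,
        smul_smul, mul_comm (w i), hvw, one_smul]
  exact Function.bijective_iff_has_inverse.2
    ⟨_, hcomp (fun i => (u i)⁻¹) u fun i => inv_mul_cancel _, hcomp _ _ fun i => mul_inv_cancel _⟩

theorem bijective_of_forall_veronese {σ R : Type*} [CommRing R] [IsDomain R]
    [UniqueFactorizationMonoid R] {d : ℕ} [NeZero d]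
    {Ψ : MvPolynomial σ R →ₐ[R] MvPolynomial σ R} (h : ∀ a : veronese σ R d, Ψ a = a) :
    Function.Bijective Ψ := by
  have hX (i : σ) : ∃ u : Rˣ, Ψ (X i) = u • X i := by
    have hpow : X i ^ d = Ψ (X i) ^ d := by simpa [powVar] using (h (powVar R d i)).symm
    obtain ⟨u, hu⟩ := (Associated.pow_iff (NeZero.ne d)).1 (Associated.of_eq hpow)
    obtain ⟨c, hc, huc⟩ := isUnit_iff_eq_C_of_isReduced.1 u.isUnit
    refine ⟨hc.unit, ?_⟩
    rw [← hu, huc, mul_comm, Units.smul_def, smul_eq_C_mul, IsUnit.unit_spec]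
  choose u hu using hX
  have hΨ : Ψ = aeval fun i => u i • X i := algHom_ext fun i => by rw [hu, aeval_X]
  exact hΨ ▸ bijective_aeval_units_smul_X u

section Field

variable {σ k : Type*} [Field k] {d : ℕ}

theorem exists_not_dvd_map_powVar [NeZero d] [Nontrivial σ]
    (α : veronese σ k d ≃ₐ[k] veronese σ k d) {p : MvPolynomial σ k} (hp : Prime p) :
    ∃ i, ¬ p ∣ (α (powVar k d i) : MvPolynomial σ k) := by
  by_contra! hall
  let P : Ideal (veronese σ k d) :=
    (Ideal.span {p}).comap ((veronese σ k d).val.comp α.toAlgHom)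
  have hmem {a : veronese σ k d} : a ∈ P ↔ p ∣ (α a : MvPolynomial σ k) :=
    Ideal.mem_span_singleton
  have : (Ideal.span {p}).IsPrime := (Ideal.span_singleton_prime hp.ne_zero).2 hp
  have hP : P.IsPrime := Ideal.comap_isPrime _ _
  have hdvd (i : σ) : ∃ c : k, p ∣ X i ^ d - C c := by
    let a := α.symm (powVar k d i)
    refine ⟨constantCoeff a.1, ?_⟩
    have ha : a - algebraMap k _ (constantCoeff a.1) ∈ P :=
      mem_of_forall_powVar_mem (fun i => hmem.2 (hall i)) (by simp [algebraMap_eq])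
    simpa [a, powVar, algebraMap_eq] using hmem.1 ha
  have hC : p = C (coeff 0 p) := eq_C_of_forall_exists_dvd fun j => by
    obtain ⟨i, hij⟩ := exists_ne j
    obtain ⟨c, hc⟩ := hdvd i
    exact ⟨_, X_pow_sub_C_ne_zero i c, degreeOf_X_pow_sub_C_of_ne hij c, hc⟩
  have hcoeff : coeff 0 p ≠ 0 := fun h => hp.ne_zero (by rw [hC, h, C_0])
  exact hp.not_isUnit (hC ▸ (isUnit_iff_ne_zero.2 hcoeff).map C)

theorem coe_map_powVar_ne_zero (α : veronese σ k d ≃ₐ[k] veronese σ k d) (i : σ) :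
    (α (powVar k d i) : MvPolynomial σ k) ≠ 0 := by
  simpa using powVar_ne_zero i

theorem exists_pow_eq_map_powVar [NeZero d] [Nontrivial σ]
    (hk : Function.Surjective fun c : k => c ^ d)
    (α : veronese σ k d ≃ₐ[k] veronese σ k d) (j : σ) :
    ∃ F : MvPolynomial σ k, F ^ d = α (powVar k d j) := by
  obtain ⟨f, u, hu⟩ := exists_associated_pow_of_forall_prime (coe_map_powVar_ne_zero α j)
      (NeZero.ne d) fun p hp => by
    obtain ⟨i, hi⟩ := exists_not_dvd_map_powVar α hp
    refine ⟨_, α (mixedVar k d i j), mt (hp.dvd_of_dvd_pow (n := d - 1)) hi, ?_⟩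
    have h := congrArg α (powVar_pow_mul_powVar (R := k) (d := d) i j)
    rw [map_mul, map_pow, map_pow] at h
    exact congrArg Subtype.val h
  obtain ⟨c, -, hc⟩ := isUnit_iff_eq_C_of_isReduced.1 u.isUnit
  obtain ⟨e, rfl⟩ := hk c
  exact ⟨f * C e, by rw [mul_pow, ← C_pow, ← hc, hu]⟩

theorem exists_algHom_extends [NeZero d] [Nontrivial σ]
    (hk : Function.Surjective fun c : k => c ^ d) (α : veronese σ k d ≃ₐ[k] veronese σ k d) :
    ∃ Ψ : MvPolynomial σ k →ₐ[k] MvPolynomial σ k, ∀ a : veronese σ k d, Ψ a = α a := by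
  obtain ⟨j⟩ : Nonempty σ := inferInstance
  obtain ⟨F, hF⟩ := exists_pow_eq_map_powVar hk α j
  have hF0 : F ≠ 0 := fun h =>
    coe_map_powVar_ne_zero α j (by rw [← hF, h, zero_pow (NeZero.ne d)])
  refine exists_algHom_extends_of_forall_dvd ((veronese σ k d).val.comp α.toAlgHom) hF0 hF
    fun i => (UniqueFactorizationMonoid.pow_dvd_pow_iff_dvd (NeZero.ne d)).1 ?_
  have h := congrArg ((veronese σ k d).val.comp α.toAlgHom) (powVar_pow_mul_powVar j i)
  rw [map_mul, map_pow, map_pow] at h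
  rw [pow_right_comm, hF]
  exact Dvd.intro _ h

theorem exists_algEquiv_extends [Nontrivial σ] (hk : Function.Surjective fun c : k => c ^ d)
    (α : veronese σ k d ≃ₐ[k] veronese σ k d) :
    ∃ Ψ : MvPolynomial σ k ≃ₐ[k] MvPolynomial σ k, ∀ a : veronese σ k d, Ψ a = α a := by
  have : NeZero d := ⟨by
    rintro rfl
    simpa using hk 0⟩
  obtain ⟨Ψ, hΨ⟩ := exists_algHom_extends hk α
  obtain ⟨Φ, hΦ⟩ := exists_algHom_extends hk α.symm
  have hΦΨ : Function.Bijective (Φ ∘ Ψ) :=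
    bijective_of_forall_veronese (d := d) (Ψ := Φ.comp Ψ) fun a => by simp [hΨ, hΦ]
  have hΨΦ : Function.Bijective (Ψ ∘ Φ) :=
    bijective_of_forall_veronese (d := d) (Ψ := Ψ.comp Φ) fun a => by simp [hΨ, hΦ]
  exact ⟨AlgEquiv.ofBijective Ψ ⟨hΦΨ.1.of_comp, hΨΦ.2.of_comp⟩, hΨ⟩

end Field

section Invariants

theorem coeff_scale {n : ℕ} (ζ : ℂ) (m : Fin n →₀ ℕ) (f : MvPolynomial (Fin n) ℂ) :
    coeff m (scale n ζ f) = ζ ^ m.degree * coeff m f := by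
  induction f using MvPolynomial.induction_on' with
  | monomial u a =>
    have hscale : scale n ζ (monomial u a) = C (ζ ^ u.degree) * monomial u a := by
      rw [scale, aeval_monomial, finsuppProd_mul_pow, monomial_eq, algebraMap_eq, C_pow,
        mul_left_comm]
    rw [hscale, coeff_C_mul, coeff_monomial]
    split_ifs with h
    · rw [h]
    · simp only [mul_zero]
  | add p q hp hq => rw [map_add, coeff_add, coeff_add, hp, hq, mul_add]

theorem invariants_eq_veronese {d n : ℕ} (hd : d ≠ 0) :
    invariants d n = veronese (Fin n) ℂ d := by
  ext f
  rw [mem_invariants, mem_veronese]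
  refine ⟨fun hf m hm => ?_, fun hf ζ => ?_⟩
  · have : NeZero d := ⟨hd⟩
    have hζ := Complex.isPrimitiveRoot_exp d hd
    have h := congrArg (coeff m) (hf hζ.toRootsOfUnity)
    rw [coeff_scale] at h
    exact hζ.dvd_of_pow_eq_one _ ((mul_eq_right₀ (mem_support_iff.1 hm)).1 h)
  · ext m
    rw [coeff_scale]
    by_cases hm : m ∈ f.support
    · obtain ⟨l, hl⟩ := hf m hm
      rw [hl, pow_mul, (mem_rootsOfUnity' d ζ.1).1 ζ.2, one_pow, one_mul]
    · rw [notMem_support_iff.1 hm, mul_zero]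

end Invariants

section Scheme

universe u

theorem exists_algEquiv_of_specIso {R A B : Type u} [CommRing R] [CommRing A] [CommRing B]
    [Algebra R A] [Algebra R B] (φ : Spec (.of B) ≅ Spec (.of A))
    (hφ : φ.hom ≫ Spec.map (CommRingCat.ofHom (algebraMap R A)) =
      Spec.map (CommRingCat.ofHom (algebraMap R B))) :
    ∃ α : A ≃ₐ[R] B, Spec.map (CommRingCat.ofHom α.toRingHom) = φ.hom := by
  let e : CommRingCat.of A ≅ CommRingCat.of B :=
    (Scheme.Spec.preimageIso (X := .op (.of B)) (Y := .op (.of A)) φ).unop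
  have he : Spec.map e.hom = φ.hom := Scheme.Spec.map_preimage φ.hom
  rw [← he, ← Spec.map_comp, Spec.map_inj] at hφ
  exact ⟨AlgEquiv.ofRingEquiv (f := e.commRingCatIsoToRingEquiv)
    fun r => DFunLike.congr_fun (congrArg CommRingCat.Hom.hom hφ) r, he⟩

variable {σ R : Type u} [CommRing R]

/-- The automorphism of affine space over `R` with pull-back `Ψ` on polynomial functions. -/
def affineSpaceIso (Ψ : MvPolynomial σ R ≃ₐ[R] MvPolynomial σ R) :
    𝔸(σ; Spec (.of R)) ≅ 𝔸(σ; Spec (.of R)) :=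
  AffineSpace.SpecIso σ (.of R) ≪≫ Scheme.Spec.mapIso Ψ.toRingEquiv.toCommRingCatIso.op ≪≫
    (AffineSpace.SpecIso σ (.of R)).symm

theorem affineSpaceIso_hom (Ψ : MvPolynomial σ R ≃ₐ[R] MvPolynomial σ R) :
    (affineSpaceIso Ψ).hom = (AffineSpace.SpecIso σ (.of R)).hom ≫
      Spec.map (CommRingCat.ofHom Ψ.toRingHom) ≫ (AffineSpace.SpecIso σ (.of R)).inv :=
  rfl

theorem affineSpaceIso_hom_isOver (Ψ : MvPolynomial σ R ≃ₐ[R] MvPolynomial σ R) :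
    (affineSpaceIso Ψ).hom.IsOver (Spec (.of R)) := by
  have hC : CommRingCat.ofHom C ≫ CommRingCat.ofHom Ψ.toRingHom = CommRingCat.ofHom C :=
    CommRingCat.hom_ext (RingHom.ext Ψ.commutes)
  refine ⟨?_⟩
  rw [affineSpaceIso_hom, Category.assoc, Category.assoc, AffineSpace.SpecIso_inv_over,
    ← Spec.map_comp, hC]
  exact ((Iso.inv_comp_eq _).1 (AffineSpace.SpecIso_inv_over (.of R))).symm

/-- The morphism from affine space to the spectrum of an algebra `S` of polynomials that is dual to
the inclusion of `S`. For the invariants of `μ_d` this is the quotient morphism. -/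
def toSpecSubalgebra (S : Subalgebra R (MvPolynomial σ R)) : 𝔸(σ; Spec (.of R)) ⟶ Spec (.of S) :=
  (AffineSpace.SpecIso σ (.of R)).hom ≫ Spec.map (CommRingCat.ofHom S.val.toRingHom)

theorem affineSpaceIso_hom_comp_toSpecSubalgebra {S : Subalgebra R (MvPolynomial σ R)}
    {α : S ≃ₐ[R] S} {Ψ : MvPolynomial σ R ≃ₐ[R] MvPolynomial σ R} (h : ∀ a : S, Ψ a = α a) :
    (affineSpaceIso Ψ).hom ≫ toSpecSubalgebra S =
      toSpecSubalgebra S ≫ Spec.map (CommRingCat.ofHom α.toRingHom) := by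
  have hcomm : CommRingCat.ofHom S.val.toRingHom ≫ CommRingCat.ofHom Ψ.toRingHom =
      CommRingCat.ofHom α.toRingHom ≫ CommRingCat.ofHom S.val.toRingHom :=
    CommRingCat.hom_ext (RingHom.ext h)
  simp only [affineSpaceIso_hom, toSpecSubalgebra, Category.assoc, Iso.inv_hom_id_assoc,
    ← Spec.map_comp, hcomm]

end Scheme

end CyclicQuotient

end

open CyclicQuotient in
theorem proposition3p1_general.{u} {σ k : Type u} [Field k] [Nontrivial σ] {d : ℕ}
    (hk : Function.Surjective fun c : k => c ^ d) {S : Subalgebra k (MvPolynomial σ k)}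
    (hS : S = veronese σ k d) (φ : Spec (.of S) ≅ Spec (.of S))
    (hφ : φ.hom ≫ Spec.map (CommRingCat.ofHom (algebraMap k S)) =
      Spec.map (CommRingCat.ofHom (algebraMap k S))) :
    ∃ ψ : 𝔸(σ; Spec (.of k)) ≅ 𝔸(σ; Spec (.of k)),
      ψ.hom.IsOver (Spec (.of k)) ∧ ψ.hom ≫ toSpecSubalgebra S = toSpecSubalgebra S ≫ φ.hom := by
  subst hS
  obtain ⟨α, hα⟩ := exists_algEquiv_of_specIso φ hφ
  obtain ⟨Ψ, hΨ⟩ := exists_algEquiv_extends hk α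
  exact ⟨affineSpaceIso Ψ, affineSpaceIso_hom_isOver Ψ,
    hα ▸ affineSpaceIso_hom_comp_toSpecSubalgebra hΨ⟩

theorem proposition3p1 (d n : ℕ) (hd : 1 < d) (hn : 2 ≤ n)
    (φ : CyclicQuotient.quotientVariety d n ≅ CyclicQuotient.quotientVariety d n)
    (hφ : φ.hom.IsOver CyclicQuotient.base) :
    ∃ ψ : CyclicQuotient.affineSpace n ≅ CyclicQuotient.affineSpace n,
      ψ.hom.IsOver CyclicQuotient.base ∧
        ψ.hom ≫ CyclicQuotient.quotientMap d n = CyclicQuotient.quotientMap d n ≫ φ.hom := by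
  have : Nontrivial (Fin n) := Fin.nontrivial_iff_two_le.2 hn
  exact proposition3p1_general
    (fun c => IsAlgClosed.exists_pow_nat_eq c (Nat.zero_lt_of_lt hd))
    (CyclicQuotient.invariants_eq_veronese (Nat.ne_zero_of_lt hd)) φ hφ.comp_over
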